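/- Let $K$ be an algebraically closed field of characteristic zero, let $T=(K^\times)^r$ be a torus with Lie algebra $\mathfrak t=K^r$, and let $V$ be a finite-dimensional algebraic representation of $T$. Write $V/\!\!/T=\operatorname{Spec}K[V]^T$, and for $v\in V$ put $\mathfrak c_v=\{x\in V\mid \mathfrak t\cdot x\subseteq \mathfrak t\cdot v\}$. A vector $x\in V$ is nilpotent if $0\in\overline{T.x}$ (Zariski closure). The representation is visible if it has only finitely many nilpotent orbits, and polar if there is $v\in V$ with $\dim\mathfrak c_v=\dim V/\!\!/T$; such a $\mathfrak c_v$ is then called a Cartan subspace. Assume that $(T,V)$ is visible. Then $(T,V)$ is polar. More precisely, $V$ has a basis of weight vectors, and for every basis $b_1,\dots,b_n$ of $V$ consisting of weight vectors, with weights $s_1,\dots,s_n\in X^*(T)=\mathbb Z^r$, the following holds. (a) There are an integer $l\ge 0$ and a partition $\{1,\dots,n\}=\bigsqcup_{j=0}^{l}I_j$ (with $I_0$ possibly empty) such that, taking linear spans in $X^*(T)\otimes_{\mathbb Z}\mathbb Q=\mathbb Q^r$: (i) $\langle s_i\mid 1\le i\le n\rangle=\bigoplus_{j=0}^{l}\langle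 s_i\mid i\in I_j\rangle$; (ii) $\dim\langle s_i\mid i\in I_0\rangle=\#I_0$, and $\dim\langle s_i\mid i\in I_j\rangle=\#I_j-1$ for $1\le j\le l$; (iii) for $1\le j\le l$, $0$ is a convex combination with all coefficients positive of the elements of $\{s_i\mid i\in I_j\}$. (b) For every $l$ and every partition as in (a), and for $w\in K^l$, let $x(w)=\sum_{j=1}^{l}w_j\sum_{i\in I_j}b_i$. Then $\mathfrak c=\{x(w)\mid w\in K^l\}$ is equal to $\mathfrak c_{x(1,\dots,1)}$, it is a Cartan subspace of $V$, and $\dim \mathfrak c=l=\dim V/\!\!/T$. -/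

import Mathlib

namespace TorusRep

noncomputable section

section Torus

variable {K : Type*} [Field K] {r : ℕ} {V : Type*} [AddCommGroup V] [Module K V]

/-- The character `t ↦ ∏ j, t_j ^ (m_j)` of the torus `(Kˣ)^r` attached to `m ∈ ℤ^r`. -/
def character (m : Fin r → ℤ) (t : Fin r → Kˣ) : K :=
  ((∏ j, t j ^ m j : Kˣ) : K)

/-- The differential at the identity of the character attached to `m`: the linear form
`ξ ↦ ∑ j, m_j ξ_j` on the Lie algebra `K^r` of the torus. -/
def characterDiff (K : Type*) [Field K] {r : ℕ} (m : Fin r → ℤ) : (Fin r → K) →ₗ[K] K :=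
  ∑ j, (m j : K) • LinearMap.proj j

/-- The representation is algebraic: `t ↦ ρ t` is a Laurent polynomial in the coordinates of `t`
with coefficients in `End V`, i.e. the matrix entries of `ρ` are regular functions on the torus. -/
def IsAlgebraic (ρ : Representation K (Fin r → Kˣ) V) : Prop :=
  ∃ P : (Fin r → ℤ) →₀ Module.End K V,
    ∀ t : Fin r → Kˣ, ρ t = P.sum fun m A => character m t • A

/-- The differential at the identity of an algebraic representation of the torus `(Kˣ)^r`: if
`ρ t = ∑ m, t^m • P_m`, then `ξ ∈ K^r` acts by `∑ m, (∑ j, m_j ξ_j) • P_m`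
(the `P_m` are uniquely determined by `ρ` when `K` is infinite). -/
def differential (ρ : Representation K (Fin r → Kˣ) V) (hρ : IsAlgebraic ρ) :
    (Fin r → K) →ₗ[K] Module.End K V :=
  hρ.choose.sum fun m A => (characterDiff K m).smulRight A

/-- The subspace `𝔱 · v` of `V`, where `𝔱 = K^r` is the Lie algebra of the torus. -/
def lieOrbit (ρ : Representation K (Fin r → Kˣ) V) (hρ : IsAlgebraic ρ) (v : V) :
    Submodule K V :=
  LinearMap.range ((differential ρ hρ).flip v)

/-- The subspace `𝔠_v = {x ∈ V | 𝔱 · x ⊆ 𝔱 · v}`. -/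
def cartanCandidate (ρ : Representation K (Fin r → Kˣ) V) (hρ : IsAlgebraic ρ) (v : V) :
    Submodule K V where
  carrier := {x | lieOrbit ρ hρ x ≤ lieOrbit ρ hρ v}
  zero_mem' := by
    rintro _ ⟨ξ, rfl⟩
    simp
  add_mem' := by
    rintro x y hx hy _ ⟨ξ, rfl⟩
    rw [map_add, LinearMap.add_apply]
    exact add_mem (hx ⟨ξ, rfl⟩) (hy ⟨ξ, rfl⟩)
  smul_mem' := by
    rintro a x hx _ ⟨ξ, rfl⟩
    rw [map_smul, LinearMap.smul_apply]
    exact Submodule.smul_mem _ a (hx ⟨ξ, rfl⟩)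

variable (K V) in
/-- The algebra `K[V]` of polynomial functions on `V`, generated by the linear forms. -/
def polyFun : Subalgebra K (V → K) :=
  Algebra.adjoin K (Set.range fun φ : Module.Dual K V => (φ : V → K))

variable (K) in
/-- The closure of a subset of `V` for the Zariski topology. -/
def zariskiClosure (S : Set V) : Set V :=
  {x | ∀ f ∈ polyFun K V, (∀ y ∈ S, f y = 0) → f x = 0}

/-- The algebra `K[V]^T` of invariant polynomial functions. -/
def invariants (ρ : Representation K (Fin r → Kˣ) V) : Subalgebra K (V → K) where
  carrier := {f | f ∈ polyFun K V ∧ ∀ t v, f (ρ t v) = f v}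
  mul_mem' := fun hf hg => ⟨mul_mem hf.1 hg.1, fun t v => by simp [hf.2, hg.2]⟩
  add_mem' := fun hf hg => ⟨add_mem hf.1 hg.1, fun t v => by simp [hf.2, hg.2]⟩
  algebraMap_mem' := fun a => ⟨Subalgebra.algebraMap_mem _ a, fun _ _ => rfl⟩

/-- The dimension of the categorical quotient `V // T = Spec K[V]^T`. -/
def quotientDim (ρ : Representation K (Fin r → Kˣ) V) : WithBot ℕ∞ :=
  ringKrullDim (invariants ρ)

/-- The orbit `T . x`. -/
def orbit (ρ : Representation K (Fin r → Kˣ) V) (x : V) : Set V :=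
  Set.range fun t => ρ t x

/-- `x` is nilpotent if `0` lies in the closure of the orbit of `x`. -/
def IsNilpotentVec (ρ : Representation K (Fin r → Kˣ) V) (x : V) : Prop :=
  (0 : V) ∈ zariskiClosure K (orbit ρ x)

/-- There are finitely many nilpotent orbits. -/
def IsVisible (ρ : Representation K (Fin r → Kˣ) V) : Prop :=
  (orbit ρ '' {x | IsNilpotentVec ρ x}).Finite

/-- `c` is a Cartan subspace: it is of the form `𝔠_v`, with `dim 𝔠_v = dim V // T`. -/
def IsCartanSubspace (ρ : Representation K (Fin r → Kˣ) V) (hρ : IsAlgebraic ρ)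
    (c : Submodule K V) : Prop :=
  ∃ v : V, c = cartanCandidate ρ hρ v ∧
    (Module.finrank K (cartanCandidate ρ hρ v) : WithBot ℕ∞) = quotientDim ρ

/-- There is `v` with `dim 𝔠_v = dim V // T`. -/
def IsPolar (ρ : Representation K (Fin r → Kˣ) V) (hρ : IsAlgebraic ρ) : Prop :=
  ∃ v : V, (Module.finrank K (cartanCandidate ρ hρ v) : WithBot ℕ∞) = quotientDim ρ

/-- The basis `b` diagonalizes the representation, `b i` having weight `s i`. -/
def IsWeightBasis (ρ : Representation K (Fin r → Kˣ) V) {n : ℕ} (b : Module.Basis (Fin n) K V)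
    (s : Fin n → Fin r → ℤ) : Prop :=
  ∀ (t : Fin r → Kˣ) (i : Fin n), ρ t (b i) = character (s i) t • b i

/-- The linear map `w ↦ x(w)`, where `x(w) ∈ V` has coordinate `0` at the indices in `I 0`
and coordinate `w j` at the indices in the `j`-th of the blocks `I 1, …, I l`. -/
def blockMap {n l : ℕ} (b : Module.Basis (Fin n) K V) (I : Fin (l + 1) → Finset (Fin n)) :
    (Fin l → K) →ₗ[K] V :=
  Fintype.linearCombination K fun j : Fin l => ∑ i ∈ I j.succ, b i

end Torus

/-- The set of convex combinations of the elements of `A` with all coefficients positive. -/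
def openConvexHull {r : ℕ} (A : Finset (Fin r → ℚ)) : Set (Fin r → ℚ) :=
  {x | ∃ α : (Fin r → ℚ) → ℚ,
    (∀ a ∈ A, 0 < α a) ∧ ∑ a ∈ A, α a = 1 ∧ ∑ a ∈ A, α a • a = x}

/-- A weight, seen in the rational vector space `X^*(T) ⊗ ℚ = ℚ^r`. -/
def ratWeight {r : ℕ} (m : Fin r → ℤ) : Fin r → ℚ := fun j => (m j : ℚ)

/-- The rational span of the weights with indices in `J`. -/
def weightSpan {n r : ℕ} (s : Fin n → Fin r → ℤ) (J : Finset (Fin n)) :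
    Submodule ℚ (Fin r → ℚ) :=
  Submodule.span ℚ ((fun i => ratWeight (s i)) '' (J : Set (Fin n)))

/-- The sets `I 0, …, I l` form a partition of the set of indices (`I 0` may be empty), such that
the span of the weights is the direct sum of the spans of the weights in each block, the weights in
`I 0` are linearly independent, and, for `j ≥ 1`, the weights in `I j` span a space of dimension
`#(I j) - 1` and have `0` as a convex combination with positive coefficients. -/
structure IsBlockPartition {n r : ℕ} (s : Fin n → Fin r → ℤ) (l : ℕ)
    (I : Fin (l + 1) → Finset (Fin n)) : Prop where
  partition : ∀ i : Fin n, ∃! j : Fin (l + 1), i ∈ I j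
  span_eq : weightSpan s Finset.univ = ⨆ j, weightSpan s (I j)
  independent : iSupIndep fun j => weightSpan s (I j)
  finrank_zero : Module.finrank ℚ (weightSpan s (I 0)) = (I 0).card
  finrank_succ : ∀ j : Fin (l + 1), j ≠ 0 →
    Module.finrank ℚ (weightSpan s (I j)) + 1 = (I j).card
  zero_mem : ∀ j : Fin (l + 1), j ≠ 0 →
    (0 : Fin r → ℚ) ∈ openConvexHull ((I j).image fun i => ratWeight (s i))

end

end TorusRep

/-! Everything is read off from the space `R` of rational relations `∑ d_i s_i = 0` between the
weights. If `a` is an integral relation, the Laurent monomial `∏ x_i ^ a_i` is constant on orbits of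
vectors whose support contains that of `a`. A vector is nilpotent as soon as no nonzero relation
with nonnegative coefficients lives on its support. Hence a relation dominating no such nonnegative
relation would produce infinitely many nilpotent orbits, separated by its Laurent monomial
(`IsVisible.exists_nonneg_relation`).

So visibility says that every nonzero element of `R` dominates a nonzero nonnegative one. This
forces `R` to be stable under positive parts (`posPart_mem_of_exists_nonneg`), and a vector
sublattice of `ℚ^n` has a basis of nonnegative vectors with disjoint supports, its atoms
(`exists_atom`). Their supports are the blocks `I_1, …, I_l`; the indices where all relations vanish
form `I_0`. The span, dimension and convexity conditions of a block partition are equivalent to this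
description of `R`, which is `IsCircuitPartition`.

Given such a partition, an invariant monomial is a product of powers of `l` primitive block
monomials, so `K[V]^T` is a polynomial ring in `l` variables (`quotientDim_eq`). Relations over `K`
have the same shape as those over `ℚ`, and linear duality then identifies `𝔠_v`, for `v = x(1,…,1)`,
with the vectors that vanish on `I_0` and are constant on every other block (`range_blockMap`). Both
dimensions are `l`. -/

namespace TorusRep

/-! ### Vector sublattices of a finite power of an ordered field -/

section Sublattice

variable {F ι : Type*} [Field F] [LinearOrder F] [IsStrictOrderedRing F] [Fintype ι]

/-- The largest multiple of `f` that can be subtracted from `d` without changing the sign of a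
positive coordinate of `d`. -/
theorem exists_scale {d f : ι → F} (h : ∃ i, 0 < d i ∧ 0 < f i) :
    ∃ c, 0 < c ∧ (∃ i, 0 < d i ∧ 0 < f i ∧ d i = c * f i) ∧
      ∀ i, 0 < d i → c * f i ≤ d i := by
  classical
  obtain ⟨i₀, h₀⟩ := h
  obtain ⟨i, hi, hmin⟩ := Finset.exists_min_image
    (Finset.univ.filter fun i => 0 < d i ∧ 0 < f i) (fun i => d i / f i) ⟨i₀, by simpa using h₀⟩
  simp only [Finset.mem_filter, Finset.mem_univ, true_and] at hi hmin
  refine ⟨d i / f i, div_pos hi.1 hi.2, ⟨i, hi.1, hi.2, ?_⟩, fun k hk => ?_⟩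
  · rw [div_mul_cancel₀ _ hi.2.ne']
  · rcases le_or_gt (f k) 0 with hf | hf
    · exact (mul_nonpos_of_nonneg_of_nonpos (div_pos hi.1 hi.2).le hf).trans hk.le
    · exact (le_div_iff₀ hf).1 (hmin k ⟨hk, hf⟩)

variable {R : Submodule F (ι → F)}

/-- If every nonzero element of `R` dominates a nonzero nonnegative element of `R`, then `R` is a
vector sublattice of `ι → F`. -/
theorem posPart_mem_of_exists_nonneg
    (hR : ∀ d ∈ R, d ≠ 0 → ∃ e ∈ R, e ≠ 0 ∧ 0 ≤ e ∧ ∀ i, d i = 0 → e i = 0) :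
    ∀ d ∈ R, (fun i => max (d i) 0) ∈ R := by
  classical
  suffices H : ∀ (N : ℕ) (d : ι → F), d ∈ R → (Finset.univ.filter fun i => d i ≠ 0).card = N →
      (fun i => max (d i) 0) ∈ R from fun d hd => H _ d hd rfl
  intro N
  induction N using Nat.strong_induction_on with
  | _ N IH =>
  intro d hd hN
  have shrink : ∀ d' ∈ R, (∀ i, d i = 0 → d' i = 0) → (∃ i, d i ≠ 0 ∧ d' i = 0) →
      (fun i => max (d' i) 0) ∈ R := by
    rintro d' hd' hsub ⟨i, hi, hi'⟩
    refine IH _ ?_ d' hd' rfl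
    rw [← hN]
    refine Finset.card_lt_card (Finset.ssubset_iff_of_subset ?_ |>.2
      ⟨i, by simpa using hi, by simpa using hi'⟩)
    intro k
    simp only [Finset.mem_filter, Finset.mem_univ, true_and]
    exact fun h h' => h (hsub k h')
  by_cases hneg : ∀ i, 0 ≤ d i
  · convert hd using 2 with i
    exact max_eq_left (hneg _)
  by_cases hpos : ∀ i, d i ≤ 0
  · convert R.zero_mem using 2 with i
    exact max_eq_right (hpos _)
  push Not at hneg hpos
  obtain ⟨n₀, hn₀⟩ := hneg
  obtain ⟨p₀, hp₀⟩ := hpos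
  -- A nonzero nonnegative element supported where `d` is negative: adding a multiple of it shrinks
  -- `d` without touching its positive part.
  obtain ⟨f, hf, hf0, hfnn, hfs⟩ : ∃ f ∈ R, f ≠ 0 ∧ 0 ≤ f ∧ ∀ i, 0 ≤ d i → f i = 0 := by
    obtain ⟨e, he, he0, henn, hes⟩ := hR d hd (fun h => by simp [h] at hp₀)
    by_cases hp : ∃ i, 0 < d i ∧ 0 < e i
    · obtain ⟨c, hc, ⟨i, hi, hei, hic⟩, hle⟩ := exists_scale hp
      have hmem : d - c • e ∈ R := R.sub_mem hd (R.smul_mem c he)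
      have hpp := shrink _ hmem (fun k hk => by simp [hk, hes k hk])
        ⟨i, hi.ne', by simp [hic]⟩
      -- The witness is the negative part of `d - c • e`. It vanishes wherever `0 ≤ d`, by the
      -- choice of `c`, and it is positive at `n₀`.
      refine ⟨_, R.sub_mem hpp hmem, ?_, ?_, ?_⟩
      · intro h
        have h1 := congrFun h n₀
        have h2 := mul_nonneg hc.le (henn n₀)
        simp only [Pi.sub_apply, Pi.smul_apply, smul_eq_mul, Pi.zero_apply] at h1 h2
        rw [max_eq_right (by linarith)] at h1
        linarith
      · intro k
        simp
      · intro k hk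
        rcases hk.lt_or_eq with hk | hk
        · have := hle k hk
          simp [this]
        · simp [← hk, hes k hk.symm]
    · refine ⟨e, he, he0, henn, fun i hi => ?_⟩
      rcases hi.lt_or_eq with hi | hi
      · by_contra h
        exact hp ⟨i, hi, lt_of_le_of_ne (henn i) (Ne.symm h)⟩
      · exact hes i hi.symm
  obtain ⟨k, hk⟩ := Function.ne_iff.1 hf0
  have hdk : d k < 0 := by
    by_contra h
    exact hk (hfs k (not_lt.1 h))
  -- `d + c • f` has the same positive part as `d` but one more zero, so the induction hypothesis
  -- applies to it.
  obtain ⟨c, hc, ⟨i, hi, hfi, hic⟩, hle⟩ := exists_scale (d := -d) (f := f)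
    ⟨k, by simpa using hdk, lt_of_le_of_ne (hfnn k) (Ne.symm hk)⟩
  have hpp := shrink _ (R.add_mem hd (R.smul_mem c hf)) (fun k hk => by simp [hk, hfs k hk.ge])
    ⟨i, by simpa using hi.ne', by simp [← hic]⟩
  convert hpp using 2 with m
  rcases le_or_gt 0 (d m) with h | h
  · simp [hfs m h]
  · have := hle m (by simpa using h)
    simp only [Pi.neg_apply] at this
    simp only [Pi.add_apply, Pi.smul_apply, smul_eq_mul]
    rw [max_eq_right h.le, max_eq_right (by linarith)]

/-- In a vector sublattice `R` of `ι → F`, every index at which some element of `R` does not vanish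
belongs to the support of an atom. -/
theorem exists_atom (hR : ∀ d ∈ R, (fun i => max (d i) 0) ∈ R) {d : ι → F} (hd : d ∈ R) {i : ι}
    (hi : d i ≠ 0) :
    ∃ e ∈ R, 0 ≤ e ∧ 0 < e i ∧ ∀ d' ∈ R, ∃ c, ∀ k, e k ≠ 0 → d' k = c * e k := by
  classical
  have signed : ∀ d ∈ R, ∀ i, d i ≠ 0 → ∃ e ∈ R, 0 ≤ e ∧ 0 < e i ∧ ∀ k, d k = 0 → e k = 0 := by
    intro d hd i hi
    rcases hi.lt_or_gt with h | h
    · refine ⟨_, hR _ (R.neg_mem hd), fun k => by simp, by simp [h], fun k hk => by simp [hk]⟩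
    · refine ⟨_, hR _ hd, fun k => by simp, by simp [h], fun k hk => by simp [hk]⟩
  obtain ⟨e₀, he₀, he₀nn, he₀i, -⟩ := signed d hd i hi
  have hex : ∃ N : ℕ, ∃ e ∈ R, 0 ≤ e ∧ 0 < e i ∧ (Finset.univ.filter fun k => e k ≠ 0).card = N :=
    ⟨_, e₀, he₀, he₀nn, he₀i, rfl⟩
  -- The atom is a nonnegative element, positive at `i`, with the fewest nonzero coordinates.
  obtain ⟨e, he, henn, hei, hcard⟩ := Nat.find_spec hex
  have hmin : ∀ e' ∈ R, 0 ≤ e' → 0 < e' i → (∀ k, e k = 0 → e' k = 0) →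
      ∀ k, e' k = 0 → e k = 0 := by
    intro e' he' hnn' hi' hsub k hk
    by_contra hne
    have hlt : (Finset.univ.filter fun k => e' k ≠ 0).card < Nat.find hex := by
      rw [← hcard]
      refine Finset.card_lt_card (Finset.ssubset_iff_of_subset ?_ |>.2
        ⟨k, by simpa using hne, by simpa using hk⟩)
      intro m
      simp only [Finset.mem_filter, Finset.mem_univ, true_and]
      exact fun h h' => h (hsub m h')
    exact Nat.find_min hex hlt ⟨e', he', hnn', hi', rfl⟩
  refine ⟨e, he, henn, hei, fun d' hd' => ⟨d' i / e i, ?_⟩⟩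
  by_contra! hcon
  obtain ⟨k, hek, hk⟩ := hcon
  obtain ⟨g, hg, hgnn, hgk, hgs⟩ := signed (d' - (d' i / e i) • e)
    (R.sub_mem hd' (R.smul_mem _ he)) k (by simpa [sub_eq_zero] using hk)
  have hgi : g i = 0 := hgs i (by simp [div_mul_cancel₀ _ hei.ne'])
  obtain ⟨c, hc, ⟨m, hm, hgm, hmc⟩, hle⟩ := exists_scale (d := e) (f := g)
    ⟨k, lt_of_le_of_ne (henn k) (Ne.symm hek), hgk⟩
  -- The positive part of `e - c • g` contradicts minimality: it is still positive at `i`, but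
  -- vanishes at `m`. The positive part is needed because `g` may be nonzero outside the support of
  -- `e`.
  refine hm.ne' (hmin _ (hR _ (R.sub_mem he (R.smul_mem c hg))) (fun k => by simp) ?_ ?_ m ?_)
  · simp [hgi, hei]
  · intro k hk
    simp only [Pi.sub_apply, hk, Pi.smul_apply, smul_eq_mul, zero_sub]
    exact max_eq_right (neg_nonpos.2 (mul_nonneg hc.le (hgnn k)))
  · simp [hmc]

end Sublattice

/-! ### Block partitions in terms of linear relations between weights -/

section Relations

variable {n r : ℕ} {s : Fin n → Fin r → ℤ}

theorem finrank_weightSpan_add_finrank_ker (J : Finset (Fin n)) :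
    Module.finrank ℚ (weightSpan s J) + Module.finrank ℚ (LinearMap.ker
      (Fintype.linearCombination ℚ fun i : J => ratWeight (s i))) = J.card := by
  have h := LinearMap.finrank_range_add_finrank_ker
    (Fintype.linearCombination ℚ fun i : J => ratWeight (s i))
  rw [Fintype.range_linearCombination, Module.finrank_fintype_fun_eq_card, Fintype.card_coe] at h
  rw [← h, weightSpan, Set.image_eq_range]
  rfl

theorem mem_ker_restrict {J : Finset (Fin n)} {d : Fin n → ℚ} :
    (fun i : J => d i) ∈ LinearMap.ker
      (Fintype.linearCombination ℚ fun i : J => ratWeight (s i)) ↔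
      ∑ i ∈ J, d i • ratWeight (s i) = 0 := by
  rw [LinearMap.mem_ker, Fintype.linearCombination_apply,
    ← Finset.sum_coe_sort J fun i => d i • ratWeight (s i)]

theorem exists_restrict_eq {J : Finset (Fin n)} (y : J → ℚ) :
    ∃ d : Fin n → ℚ, y = fun i : J => d i := by
  classical
  exact ⟨fun i => if h : i ∈ J then y ⟨i, h⟩ else 0, by ext i; simp⟩

theorem finrank_weightSpan_eq_card_iff {J : Finset (Fin n)} :
    Module.finrank ℚ (weightSpan s J) = J.card ↔
      ∀ d : Fin n → ℚ, ∑ i ∈ J, d i • ratWeight (s i) = 0 → ∀ i ∈ J, d i = 0 := by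
  have h := finrank_weightSpan_add_finrank_ker (s := s) J
  have h' : Module.finrank ℚ (weightSpan s J) = J.card ↔ Module.finrank ℚ (LinearMap.ker
      (Fintype.linearCombination ℚ fun i : J => ratWeight (s i))) = 0 := by omega
  rw [h', Submodule.finrank_eq_zero, Submodule.eq_bot_iff]
  constructor
  · intro H d hd i hi
    exact congrFun (H _ (mem_ker_restrict.2 hd)) ⟨i, hi⟩
  · intro H y hy
    obtain ⟨d, rfl⟩ := exists_restrict_eq y
    ext i
    exact H d (mem_ker_restrict.1 hy) i i.2

/-- By rank-nullity the relations on `J` form a line exactly when the span has dimension one less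
than `J.card`; `e`, nonzero because `J` is nonempty, then spans that line. -/
theorem finrank_weightSpan_add_one_eq_card_iff {J : Finset (Fin n)} {e : Fin n → ℚ}
    (hJ : J.Nonempty) (hpos : ∀ i ∈ J, 0 < e i) (he : ∑ i ∈ J, e i • ratWeight (s i) = 0) :
    Module.finrank ℚ (weightSpan s J) + 1 = J.card ↔
      ∀ d : Fin n → ℚ, ∑ i ∈ J, d i • ratWeight (s i) = 0 → ∃ c, ∀ i ∈ J, d i = c * e i := by
  have h := finrank_weightSpan_add_finrank_ker (s := s) J
  have h' : Module.finrank ℚ (weightSpan s J) + 1 = J.card ↔ Module.finrank ℚ (LinearMap.ker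
      (Fintype.linearCombination ℚ fun i : J => ratWeight (s i))) = 1 := by omega
  obtain ⟨i₀, hi₀⟩ := hJ
  rw [h', finrank_eq_one_iff_of_nonzero' ⟨_, mem_ker_restrict.2 he⟩]
  · constructor
    · intro H d hd
      obtain ⟨c, hc⟩ := H ⟨_, mem_ker_restrict.2 hd⟩
      refine ⟨c, fun i hi => ?_⟩
      have := congrFun (congrArg Subtype.val hc) ⟨i, hi⟩
      simpa using this.symm
    · rintro H ⟨y, hy⟩
      obtain ⟨d, rfl⟩ := exists_restrict_eq y
      obtain ⟨c, hc⟩ := H d (mem_ker_restrict.1 hy)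
      refine ⟨c, Subtype.ext (funext fun i => ?_)⟩
      simpa using (hc i i.2).symm
  · intro H
    have := congrFun (congrArg Subtype.val H) ⟨i₀, hi₀⟩
    exact (hpos i₀ hi₀).ne' this

theorem sum_eq_sum_blocks {l : ℕ} {I : Fin (l + 1) → Finset (Fin n)}
    (hI : ∀ i : Fin n, ∃! j, i ∈ I j) {M : Type*} [AddCommMonoid M] (f : Fin n → M) :
    ∑ i, f i = ∑ j, ∑ i ∈ I j, f i := by
  choose blk hblk huniq using hI
  rw [← Finset.sum_fiberwise Finset.univ blk f]
  refine Finset.sum_congr rfl fun j _ => Finset.sum_congr ?_ fun _ _ => rfl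
  ext i
  simp only [Finset.mem_filter, Finset.mem_univ, true_and]
  exact ⟨fun h => h ▸ hblk i, fun h => (huniq i j h).symm⟩

/-- A relation between the weights with indices in `J` extends by zero. -/
theorem exists_extend_relation (d : Fin n → ℚ) (J : Finset (Fin n))
    (hd : ∑ i ∈ J, d i • ratWeight (s i) = 0) :
    ∃ d' : Fin n → ℚ, (∀ i ∈ J, d' i = d i) ∧ ∑ i, d' i • ratWeight (s i) = 0 := by
  classical
  refine ⟨fun i => if i ∈ J then d i else 0, fun i hi => if_pos hi, ?_⟩
  simpa [ite_smul, Finset.sum_ite_mem] using hd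

/-- A description of a block partition through the linear relations between the weights: every
relation vanishes on `I 0`, and on each other block it is a multiple of a relation with positive
coefficients. -/
structure IsCircuitPartition (s : Fin n → Fin r → ℤ) (l : ℕ) (I : Fin (l + 1) → Finset (Fin n))
    (e : Fin n → ℚ) : Prop where
  partition : ∀ i : Fin n, ∃! j : Fin (l + 1), i ∈ I j
  nonempty : ∀ j, j ≠ 0 → (I j).Nonempty
  pos : ∀ j, j ≠ 0 → ∀ i ∈ I j, 0 < e i
  rel : ∀ j, j ≠ 0 → ∑ i ∈ I j, e i • ratWeight (s i) = 0
  zero : ∀ d : Fin n → ℚ, ∑ i, d i • ratWeight (s i) = 0 → ∀ i ∈ I 0, d i = 0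
  proportional : ∀ d : Fin n → ℚ, ∑ i, d i • ratWeight (s i) = 0 → ∀ j, j ≠ 0 →
    ∃ c, ∀ i ∈ I j, d i = c * e i

variable {l : ℕ} {I : Fin (l + 1) → Finset (Fin n)}

theorem mem_weightSpan {J : Finset (Fin n)} {x : Fin r → ℚ} :
    x ∈ weightSpan s J ↔ ∃ d : Fin n → ℚ, ∑ i ∈ J, d i • ratWeight (s i) = x :=
  Submodule.mem_span_image_finset_iff_exists_fun' ℚ

/-- The hull involves the set of distinct weights, a relation involves indices. A coefficient is
shared equally among the indices carrying the same weight; conversely, coefficients of equal weights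
are added and the total is normalised to `1`. -/
theorem zero_mem_openConvexHull_image_iff {J : Finset (Fin n)} (hJ : J.Nonempty) :
    (0 : Fin r → ℚ) ∈ openConvexHull (J.image fun i => ratWeight (s i)) ↔
      ∃ e : Fin n → ℚ, (∀ i ∈ J, 0 < e i) ∧ ∑ i ∈ J, e i • ratWeight (s i) = 0 := by
  classical
  constructor
  · rintro ⟨α, hpos, -, hsum⟩
    have hcard : ∀ i ∈ J, 0 < (J.filter fun k => ratWeight (s k) = ratWeight (s i)).card :=
      fun i hi => Finset.card_pos.2 ⟨i, by simp [hi]⟩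
    refine ⟨fun i => α (ratWeight (s i)) /
      (J.filter fun k => ratWeight (s k) = ratWeight (s i)).card, fun i hi => ?_, ?_⟩
    · exact div_pos (hpos _ (Finset.mem_image_of_mem _ hi)) (by exact_mod_cast hcard i hi)
    · rw [Finset.sum_comp (fun a => (α a / (J.filter fun k => ratWeight (s k) = a).card : ℚ) • a)
        (fun i => ratWeight (s i)), ← hsum]
      refine Finset.sum_congr rfl fun a ha => ?_
      obtain ⟨i, hi, rfl⟩ := Finset.mem_image.1 ha
      have := (hcard i hi).ne'
      rw [← Nat.cast_smul_eq_nsmul ℚ, smul_smul, mul_div_cancel₀ _ (by exact_mod_cast this)]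
  · rintro ⟨e, hpos, hsum⟩
    have hE : 0 < ∑ i ∈ J, e i := Finset.sum_pos hpos hJ
    refine ⟨fun a => (∑ i ∈ J with ratWeight (s i) = a, e i) / ∑ i ∈ J, e i, ?_, ?_, ?_⟩
    · intro a ha
      obtain ⟨i, hi, rfl⟩ := Finset.mem_image.1 ha
      refine div_pos (Finset.sum_pos (fun k hk => hpos k (Finset.mem_filter.1 hk).1) ?_) hE
      exact ⟨i, by simp [hi]⟩
    · rw [← Finset.sum_div, Finset.sum_fiberwise_of_maps_to
        (fun i hi => Finset.mem_image_of_mem _ hi), div_self hE.ne']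
    · simp_rw [div_eq_inv_mul, mul_smul, ← Finset.smul_sum, Finset.sum_smul]
      rw [← smul_zero (∑ i ∈ J, e i)⁻¹, ← hsum, ← Finset.sum_fiberwise_of_maps_to
        (t := J.image fun i => ratWeight (s i)) (g := fun i => ratWeight (s i))
        (fun i hi => Finset.mem_image_of_mem _ hi) fun i => e i • ratWeight (s i)]
      congr 1
      refine Finset.sum_congr rfl fun a _ => Finset.sum_congr rfl fun i hi => ?_
      rw [(Finset.mem_filter.1 hi).2]

/-- Independence of the block spans cuts every relation into relations on the single blocks, where
the dimension conditions apply. -/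
theorem IsBlockPartition.exists_isCircuitPartition (h : IsBlockPartition s l I) :
    ∃ e, IsCircuitPartition s l I e := by
  have hne : ∀ j, j ≠ 0 → (I j).Nonempty := fun j hj =>
    Finset.card_pos.1 (by have := h.finrank_succ j hj; omega)
  have hex : ∀ j, ∃ e : Fin n → ℚ, j ≠ 0 →
      (∀ i ∈ I j, 0 < e i) ∧ ∑ i ∈ I j, e i • ratWeight (s i) = 0 := by
    intro j
    by_cases hj : j = 0
    · exact ⟨0, fun h => (h hj).elim⟩
    · obtain ⟨e, he⟩ := (zero_mem_openConvexHull_image_iff (hne j hj)).1 (h.zero_mem j hj)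
      exact ⟨e, fun _ => he⟩
  choose e he using hex
  choose blk hblk huniq using h.partition
  have hb : ∀ j, ∀ i ∈ I j, blk i = j := fun j i hi => (huniq i j hi).symm
  have hrel : ∀ j, j ≠ 0 → ∑ i ∈ I j, e (blk i) i • ratWeight (s i) = 0 := fun j hj => by
    rw [← (he j hj).2]
    exact Finset.sum_congr rfl fun i hi => by rw [hb j i hi]
  have hblock : ∀ d : Fin n → ℚ, ∑ i, d i • ratWeight (s i) = 0 →
      ∀ j, ∑ i ∈ I j, d i • ratWeight (s i) = 0 := by
    intro d hd j
    rw [sum_eq_sum_blocks h.partition] at hd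
    exact (iSupIndep_iff_finsetSum_eq_zero_imp_eq_zero _).1 h.independent Finset.univ
      (fun j => ∑ i ∈ I j, d i • ratWeight (s i)) (fun j _ => mem_weightSpan.2 ⟨d, rfl⟩) hd j
      (Finset.mem_univ j)
  have hpos : ∀ j, j ≠ 0 → ∀ i ∈ I j, 0 < e (blk i) i := fun j hj i hi => by
    rw [hb j i hi]
    exact (he j hj).1 i hi
  exact ⟨fun i => e (blk i) i, h.partition, hne, hpos, hrel,
    fun d hd => finrank_weightSpan_eq_card_iff.1 h.finrank_zero d (hblock d hd 0),
    fun d hd j hj => (finrank_weightSpan_add_one_eq_card_iff (hne j hj) (hpos j hj)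
      (hrel j hj)).1 (h.finrank_succ j hj) d (hblock d hd j)⟩

namespace IsCircuitPartition

variable {e : Fin n → ℚ}

/-- A relation between the weights restricts to a relation in each block. -/
theorem sum_block_eq_zero (h : IsCircuitPartition s l I e) {d : Fin n → ℚ}
    (hd : ∑ i, d i • ratWeight (s i) = 0) (j : Fin (l + 1)) : ∑ i ∈ I j, d i • ratWeight (s i) = 0 := by
  by_cases hj : j = 0
  · subst hj
    exact Finset.sum_eq_zero fun i hi => by rw [h.zero d hd i hi, zero_smul]
  · obtain ⟨c, hc⟩ := h.proportional d hd j hj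
    rw [Finset.sum_congr rfl fun i hi => by rw [hc i hi, mul_smul], ← Finset.smul_sum,
      h.rel j hj, smul_zero]

theorem isBlockPartition (h : IsCircuitPartition s l I e) : IsBlockPartition s l I where
  partition := h.partition
  span_eq := by
    simp_rw [weightSpan]
    rw [← Submodule.span_iUnion, ← Set.image_iUnion]
    congr 2
    ext i
    obtain ⟨j, hj, -⟩ := h.partition i
    simpa using ⟨j, hj⟩
  independent := by
    rw [iSupIndep_iff_finsetSum_eq_zero_imp_eq_zero]
    classical
    intro S v hv hsum
    have hex : ∀ j, ∃ d : Fin n → ℚ, ∑ i ∈ I j, d i • ratWeight (s i) = if j ∈ S then v j else 0 := by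
      intro j
      refine mem_weightSpan.1 ?_
      split_ifs with hj
      exacts [hv j hj, Submodule.zero_mem _]
    choose d hd using hex
    choose blk hblk huniq using h.partition
    have hb : ∀ j, ∑ i ∈ I j, d (blk i) i • ratWeight (s i) = if j ∈ S then v j else 0 := by
      intro j
      rw [← hd j]
      exact Finset.sum_congr rfl fun i hi => by rw [← huniq i j hi]
    intro j hj
    -- Vectors of the block spans with sum zero glue to one global relation, and a global relation
    -- has zero sum on each block.
    have h0 : ∑ i, d (blk i) i • ratWeight (s i) = 0 := by
      rw [sum_eq_sum_blocks h.partition, Finset.sum_congr rfl fun j _ => hb j]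
      simpa [Finset.sum_ite_mem] using hsum
    have := h.sum_block_eq_zero h0 j
    rwa [hb j, if_pos hj] at this
  finrank_zero := by
    refine finrank_weightSpan_eq_card_iff.2 fun d hd i hi => ?_
    obtain ⟨d', hd', hd0⟩ := exists_extend_relation d (I 0) hd
    rw [← hd' i hi, h.zero d' hd0 i hi]
  finrank_succ := by
    intro j hj
    refine (finrank_weightSpan_add_one_eq_card_iff (h.nonempty j hj) (h.pos j hj)
      (h.rel j hj)).2 fun d hd => ?_
    obtain ⟨d', hd', hd0⟩ := exists_extend_relation d (I j) hd
    obtain ⟨c, hc⟩ := h.proportional d' hd0 j hj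
    exact ⟨c, fun i hi => by rw [← hd' i hi, hc i hi]⟩
  zero_mem := fun j hj => (zero_mem_openConvexHull_image_iff (h.nonempty j hj)).2
    ⟨e, h.pos j hj, h.rel j hj⟩

end IsCircuitPartition

end Relations

/-! ### Existence of the partition -/

section Existence

variable {n r : ℕ} {s : Fin n → Fin r → ℤ}

/-- If every nontrivial relation between the weights dominates a nontrivial relation with nonnegative
coefficients, then the weights have a block partition. -/
theorem exists_isCircuitPartition
    (hR : ∀ d : Fin n → ℚ, ∑ i, d i • ratWeight (s i) = 0 → d ≠ 0 →
      ∃ e : Fin n → ℚ, ∑ i, e i • ratWeight (s i) = 0 ∧ e ≠ 0 ∧ 0 ≤ e ∧ ∀ i, d i = 0 → e i = 0) :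
    ∃ (l : ℕ) (I : Fin (l + 1) → Finset (Fin n)) (e : Fin n → ℚ), IsCircuitPartition s l I e := by
  classical
  let R : Submodule ℚ (Fin n → ℚ) :=
    LinearMap.ker (Fintype.linearCombination ℚ fun i => ratWeight (s i))
  have hmem : ∀ d, d ∈ R ↔ ∑ i, d i • ratWeight (s i) = 0 := fun d => by
    rw [LinearMap.mem_ker, Fintype.linearCombination_apply]
  have hlat := posPart_mem_of_exists_nonneg (R := R) (by simpa only [hmem] using hR)
  let P : Finset (Fin n) → (Fin n → ℚ) → Prop := fun A e =>
    e ∈ R ∧ 0 ≤ e ∧ (∀ k, k ∈ A ↔ e k ≠ 0) ∧ ∀ d ∈ R, ∃ c, ∀ k ∈ A, d k = c * e k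
  let 𝒜 : Finset (Finset (Fin n)) := Finset.univ.filter fun A => A.Nonempty ∧ ∃ e, P A e
  have h𝒜 : ∀ A : 𝒜, A.1.Nonempty ∧ ∃ e, P A e := fun A => (Finset.mem_filter.1 A.2).2
  let A : Fin 𝒜.card ≃ 𝒜 := 𝒜.equivFin.symm
  choose e heR henn hesupp heprop using fun j => (h𝒜 (A j)).2
  -- On the support of an atom any other atom is a scalar multiple of it. The scalar is nonzero once
  -- the supports meet, so meeting supports coincide.
  have hsub : ∀ j j' i, i ∈ (A j).1 → i ∈ (A j').1 → (A j).1 ⊆ (A j').1 := by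
    intro j j' i hi hi' k hk
    obtain ⟨c, hc⟩ := heprop j (e j') (heR j')
    have hne := (hesupp j' i).1 hi'
    rw [hc i hi] at hne
    rw [hesupp, hc k hk]
    exact mul_ne_zero (left_ne_zero_of_mul hne) ((hesupp j k).1 hk)
  have hdisj : ∀ j j' i, i ∈ (A j).1 → i ∈ (A j').1 → j = j' := fun j j' i hi hi' =>
    A.injective (Subtype.ext ((hsub j j' i hi hi').antisymm (hsub j' j i hi' hi)))
  have hblock : ∀ j, ∀ i ∈ (A j).1, ∑ j', e j' i = e j i := by
    intro j i hi
    refine Finset.sum_eq_single j (fun j' _ hj' => ?_) (by simp)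
    by_contra hne
    exact hj' (hdisj j' j i ((hesupp j' i).2 hne) hi)
  refine ⟨𝒜.card, Fin.cons (Finset.univ.filter fun i => ∀ d ∈ R, d i = 0) fun j => (A j).1,
    fun i => ∑ j, e j i, ?_, ?_, ?_, ?_, ?_, ?_⟩
  · intro i
    by_cases hi : ∀ d ∈ R, d i = 0
    · refine ⟨0, by simpa using hi, fun j => Fin.cases (fun _ => rfl) (fun j hj => ?_) j⟩
      exact ((hesupp j i).1 hj (hi _ (heR j))).elim
    · obtain ⟨d, hd, hdi⟩ : ∃ d ∈ R, d i ≠ 0 := by simpa using hi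
      obtain ⟨f, hf, hfnn, hfi, hfprop⟩ := exists_atom hlat hd hdi
      have hA : (Finset.univ.filter fun k => f k ≠ 0) ∈ 𝒜 := by
        refine Finset.mem_filter.2 ⟨Finset.mem_univ _, ⟨i, by simpa using hfi.ne'⟩,
          f, hf, hfnn, by simp, fun d hd => ?_⟩
        obtain ⟨c, hc⟩ := hfprop d hd
        exact ⟨c, fun k hk => hc k (by simpa using hk)⟩
      have hij : i ∈ (A (A.symm ⟨_, hA⟩)).1 := by simpa using hfi.ne'
      refine ⟨Fin.succ (A.symm ⟨_, hA⟩), by simpa only [Fin.cons_succ] using hij,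
        fun j => Fin.cases (fun h0 => ?_) (fun j hj => ?_) j⟩
      · exact (hi (by simpa using h0)).elim
      · exact congrArg Fin.succ (hdisj _ _ i hj hij)
  · exact fun j => Fin.cases (fun h => (h rfl).elim) (fun j _ => (h𝒜 (A j)).1) j
  · refine fun j => Fin.cases (fun h => (h rfl).elim) (fun j _ i hi => ?_) j
    rw [Fin.cons_succ] at hi
    rw [hblock j i hi]
    exact lt_of_le_of_ne (henn j i) ((hesupp j i).1 hi).symm
  · refine fun j => Fin.cases (fun h => (h rfl).elim) (fun j _ => ?_) j
    rw [Fin.cons_succ, ← (hmem _).1 (heR j)]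
    rw [Finset.sum_congr rfl fun i hi => by rw [hblock j i hi]]
    refine Finset.sum_subset (Finset.subset_univ _) fun i _ hi => ?_
    rw [not_not.1 (mt (hesupp j i).2 hi), zero_smul]
  · intro d hd i hi
    exact (Finset.mem_filter.1 hi).2 d ((hmem d).2 hd)
  · intro d hd
    refine fun j => Fin.cases (fun h => (h rfl).elim) (fun j _ => ?_) j
    obtain ⟨c, hc⟩ := heprop j d ((hmem d).2 hd)
    refine ⟨c, fun i hi => ?_⟩
    rw [Fin.cons_succ] at hi
    rw [hblock j i hi, hc i hi]

end Existence

/-! ### Integral relations and relations over `K` -/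

section Integral

variable {n r : ℕ} {s : Fin n → Fin r → ℤ}

theorem sum_smul_ratWeight_eq_zero_iff (J : Finset (Fin n)) (a : Fin n → ℤ) :
    ∑ i ∈ J, (a i : ℚ) • ratWeight (s i) = 0 ↔ ∑ i ∈ J, a i • s i = 0 := by
  rw [funext_iff, funext_iff]
  refine forall_congr' fun k => ?_
  simp only [Finset.sum_apply, Pi.smul_apply, ratWeight, smul_eq_mul, Pi.zero_apply]
  exact_mod_cast Iff.rfl

theorem exists_int_multiple (d : Fin n → ℚ) :
    ∃ N : ℤ, 0 < N ∧ ∃ a : Fin n → ℤ, ∀ i, (a i : ℚ) = N * d i := by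
  obtain ⟨⟨N, hN⟩, hb⟩ := IsLocalization.exist_integer_multiples_of_finite (nonZeroDivisors ℤ) d
  choose a ha using hb
  have hN0 : N ≠ 0 := nonZeroDivisors.ne_zero hN
  rcases hN0.lt_or_gt with h | h
  · refine ⟨-N, by omega, fun i => -a i, fun i => ?_⟩
    have := ha i
    simp only [algebraMap_int_eq, eq_intCast, zsmul_eq_mul] at this
    simp [this]
  · refine ⟨N, h, a, fun i => ?_⟩
    have := ha i
    simpa only [algebraMap_int_eq, eq_intCast, zsmul_eq_mul] using this

variable {l : ℕ} {I : Fin (l + 1) → Finset (Fin n)} {e : Fin n → ℚ}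

/-- Each block carries a primitive relation with positive integral coefficients, of which all
relations with natural coefficients are natural multiples on that block. -/
theorem IsCircuitPartition.exists_primitive_block (h : IsCircuitPartition s l I e)
    (j : Fin (l + 1)) (hj : j ≠ 0) :
    ∃ c : Fin n → ℕ, (∀ i ∈ I j, 0 < c i) ∧ ∑ i ∈ I j, (c i : ℤ) • s i = 0 ∧
      ∀ a : Fin n → ℕ, ∑ i, (a i : ℤ) • s i = 0 → ∃ k : ℕ, ∀ i ∈ I j, a i = k * c i := by
  classical
  obtain ⟨i₀, hi₀⟩ := h.nonempty j hj
  have hprop : ∀ a : Fin n → ℤ, ∑ i, a i • s i = 0 → ∃ q : ℚ, ∀ i ∈ I j, (a i : ℚ) = q * e i :=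
    fun a ha => h.proportional (fun i => (a i : ℚ)) ((sum_smul_ratWeight_eq_zero_iff _ _).2 ha) j hj
  -- The primitive relation is an integral relation with the least positive value at `i₀`.
  have hex : ∃ m : ℕ, 0 < m ∧ ∃ a : Fin n → ℤ, ∑ i, a i • s i = 0 ∧ a i₀ = m := by
    obtain ⟨e', he', hsum⟩ := exists_extend_relation e (I j) (h.rel j hj)
    obtain ⟨N, hN, a, ha⟩ := exists_int_multiple e'
    have hai : 0 < a i₀ := by
      have : (0 : ℚ) < a i₀ := by
        rw [ha, he' i₀ hi₀]
        exact mul_pos (by exact_mod_cast hN) (h.pos j hj i₀ hi₀)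
      exact_mod_cast this
    refine ⟨(a i₀).toNat, by omega, a, ?_, by omega⟩
    rw [← sum_smul_ratWeight_eq_zero_iff]
    simp_rw [ha, mul_smul]
    rw [← Finset.smul_sum, hsum, smul_zero]
  obtain ⟨hm, b, hb, hbi⟩ := Nat.find_spec hex
  have hmin : ∀ a : Fin n → ℤ, ∑ i, a i • s i = 0 → 0 ≤ a i₀ → a i₀ < Nat.find hex → a i₀ = 0 := by
    intro a ha h0 hlt
    by_contra hne
    refine Nat.find_min hex (m := (a i₀).toNat) (by omega) ⟨by omega, a, ha, by omega⟩
  obtain ⟨q, hq⟩ := hprop b hb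
  have he₀ := h.pos j hj i₀ hi₀
  have hq0 : 0 < q := by
    have : (0 : ℚ) < q * e i₀ := by
      rw [← hq i₀ hi₀, hbi]
      exact_mod_cast hm
    exact (pos_iff_pos_of_mul_pos this).2 he₀
  have hbpos : ∀ i ∈ I j, 0 < b i := fun i hi => by
    have : (0 : ℚ) < b i := by
      rw [hq i hi]
      exact mul_pos hq0 (h.pos j hj i hi)
    exact_mod_cast this
  have hcast : ∀ i ∈ I j, ((b i).toNat : ℤ) = b i := fun i hi => Int.toNat_of_nonneg (hbpos i hi).le
  refine ⟨fun i => (b i).toNat, fun i hi => Int.pos_iff_toNat_pos.1 (hbpos i hi), ?_, fun a ha => ?_⟩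
  · rw [Finset.sum_congr rfl fun i hi => by rw [hcast i hi], ← sum_smul_ratWeight_eq_zero_iff]
    exact h.sum_block_eq_zero ((sum_smul_ratWeight_eq_zero_iff _ _).2 hb) j
  · let k : ℤ := (a i₀ : ℤ) / b i₀
    have hk : 0 ≤ k := Int.ediv_nonneg (by positivity) (hbpos i₀ hi₀).le
    have hrel : ∑ i, ((a i : ℤ) - k * b i) • s i = 0 := by
      simp_rw [sub_smul, mul_smul]
      rw [Finset.sum_sub_distrib, ← Finset.smul_sum, ha, hb]
      simp
    have hmod : (a i₀ : ℤ) - k * b i₀ = (a i₀ : ℤ) % b i₀ := by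
      rw [Int.emod_def, mul_comm]
    have hz := hmin (fun i => (a i : ℤ) - k * b i) hrel
      (by rw [hmod]; exact Int.emod_nonneg _ (hbpos i₀ hi₀).ne')
      (by rw [hmod, ← hbi]; exact Int.emod_lt_of_pos _ (hbpos i₀ hi₀))
    obtain ⟨p, hp⟩ := hprop _ hrel
    have hp0 : p = 0 := by
      have := hp i₀ hi₀
      rw [hz, Int.cast_zero, eq_comm, mul_eq_zero] at this
      exact this.resolve_right he₀.ne'
    refine ⟨k.toNat, fun i hi => ?_⟩
    have h1 := hp i hi
    rw [hp0, zero_mul, Int.cast_eq_zero] at h1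
    zify
    rw [hcast i hi, Int.toNat_of_nonneg hk]
    omega

theorem IsCircuitPartition.exists_primitive (h : IsCircuitPartition s l I e) :
    ∃ c : Fin n → ℕ, (∀ j : Fin l, ∀ i ∈ I j.succ, 0 < c i) ∧
      (∀ j : Fin l, ∑ i ∈ I j.succ, (c i : ℤ) • s i = 0) ∧
      ∀ a : Fin n → ℕ, ∑ i, (a i : ℤ) • s i = 0 →
        (∀ i ∈ I 0, a i = 0) ∧ ∃ k : Fin l → ℕ, ∀ j, ∀ i ∈ I j.succ, a i = k j * c i := by
  choose c hpos hrel hprop using fun j : Fin l => h.exists_primitive_block j.succ j.succ_ne_zero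
  choose blk hblk huniq using h.partition
  -- The block relations are glued into one exponent vector; its value on `I 0` is irrelevant and
  -- set to `0`.
  have hex : ∀ i, ∃ m : ℕ, ∀ j : Fin l, i ∈ I j.succ → m = c j i := by
    intro i
    by_cases hi : ∃ j : Fin l, i ∈ I j.succ
    · obtain ⟨j, hj⟩ := hi
      refine ⟨c j i, fun j' hj' => ?_⟩
      rw [Fin.succ_injective l ((huniq i _ hj).trans (huniq i _ hj').symm)]
    · exact ⟨0, fun j hj => (hi ⟨j, hj⟩).elim⟩
  choose m hm using hex
  refine ⟨m, fun j i hi => ?_, fun j => ?_, fun a ha => ⟨fun i hi => ?_, ?_⟩⟩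
  · rw [hm i j hi]
    exact hpos j i hi
  · rw [← hrel j]
    exact Finset.sum_congr rfl fun i hi => by rw [hm i j hi]
  · have := h.zero (fun i => ((a i : ℤ) : ℚ)) ((sum_smul_ratWeight_eq_zero_iff _ _).2 ha) i hi
    exact_mod_cast this
  · choose k hk using fun j => hprop j a ha
    exact ⟨k, fun j i hi => by rw [hk j i hi, hm i j hi]⟩

/-- The relations between the weights over an extension field of `ℚ` have the same description as
the rational ones. -/
theorem IsCircuitPartition.zero_and_proportional_of_charZero (h : IsCircuitPartition s l I e)
    {K : Type*} [Field K] [CharZero K] {d : Fin n → K}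
    (hd : ∀ k, ∑ i, d i * (s i k : K) = 0) :
    (∀ i ∈ I 0, d i = 0) ∧ ∀ j : Fin l, ∃ c, ∀ i ∈ I j.succ, d i = c * (e i : K) := by
  -- A `ℚ`-linear form on `K` turns a relation over `K` into a rational one, and such forms separate
  -- the points of `K`.
  have hφ : ∀ φ : Module.Dual ℚ K, ∑ i, φ (d i) • ratWeight (s i) = 0 := by
    intro φ
    ext k
    have : φ (∑ i, d i * (s i k : K)) = 0 := by rw [hd k, map_zero]
    rw [map_sum] at this
    simp only [Finset.sum_apply, Pi.smul_apply, ratWeight, smul_eq_mul, Pi.zero_apply]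
    rw [← this]
    refine Finset.sum_congr rfl fun i _ => ?_
    rw [mul_comm (d i), ← zsmul_eq_mul, map_zsmul, zsmul_eq_mul, mul_comm]
  refine ⟨fun i hi => ?_, fun j => ?_⟩
  · exact (Module.forall_dual_apply_eq_zero_iff ℚ (d i)).1 fun φ => h.zero _ (hφ φ) i hi
  · obtain ⟨i₀, hi₀⟩ := h.nonempty j.succ j.succ_ne_zero
    have he₀ := (h.pos _ j.succ_ne_zero i₀ hi₀).ne'
    refine ⟨d i₀ / e i₀, fun i hi => ?_⟩
    have : e i₀ • d i - e i • d i₀ = 0 := by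
      refine (Module.forall_dual_apply_eq_zero_iff ℚ _).1 fun φ => ?_
      obtain ⟨c, hc⟩ := h.proportional _ (hφ φ) j.succ j.succ_ne_zero
      rw [map_sub, map_smul, map_smul, hc i hi, hc i₀ hi₀, smul_eq_mul, smul_eq_mul]
      ring
    rw [Rat.smul_def, Rat.smul_def, sub_eq_zero] at this
    have he₀' : (e i₀ : K) ≠ 0 := by exact_mod_cast he₀
    field_simp
    linear_combination this

end Integral

/-! ### Linear independence of characters -/

section Characters

variable {K : Type*} [Field K] {r : ℕ}

theorem character_eq_prod (m : Fin r → ℤ) (t : Fin r → Kˣ) :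
    character m t = ∏ j, (t j : K) ^ m j := by
  simp [character]

theorem character_zero (t : Fin r → Kˣ) : (character 0 t : K) = 1 := by
  simp [character_eq_prod]

theorem character_one (m : Fin r → ℤ) : (character m (1 : Fin r → Kˣ) : K) = 1 := by
  simp [character_eq_prod]

theorem character_mul (m : Fin r → ℤ) (t u : Fin r → Kˣ) :
    (character m (t * u) : K) = character m t * character m u := by
  simp [character_eq_prod, mul_zpow, Finset.prod_mul_distrib]

theorem character_sum_zsmul {ι : Type*} (S : Finset ι) (a : ι → ℤ) (s : ι → Fin r → ℤ)
    (t : Fin r → Kˣ) :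
    (character (∑ i ∈ S, a i • s i) t : K) = ∏ i ∈ S, character (s i) t ^ a i := by
  classical
  induction S using Finset.induction_on with
  | empty => simp [character_zero]
  | insert i S hi IH =>
    rw [Finset.sum_insert hi, Finset.prod_insert hi, ← IH]
    simp only [character_eq_prod, Pi.add_apply, Pi.smul_apply, smul_eq_mul]
    rw [← Finset.prod_zpow, ← Finset.prod_mul_distrib]
    refine Finset.prod_congr rfl fun j _ => ?_
    rw [zpow_add₀ (Units.ne_zero _), mul_comm (a i), zpow_mul]

/-- The element `2` has infinite order in `Kˣ`, so placing it in the `j`-th coordinate and `1`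
elsewhere detects `m j`. -/
theorem character_injective [CharZero K] :
    Function.Injective (character : (Fin r → ℤ) → (Fin r → Kˣ) → K) := by
  intro m m' h
  ext j
  have h2 : (2 : K) ≠ 0 := two_ne_zero
  have key : ∀ m : Fin r → ℤ,
      (character m (Pi.mulSingle j (Units.mk0 (2 : K) h2)) : K) = (2 : K) ^ m j := by
    intro m
    rw [character_eq_prod, Finset.prod_eq_single j]
    · simp
    · intro k _ hk
      simp [Pi.mulSingle_eq_of_ne hk]
    · simp
  have hj := congrFun h (Pi.mulSingle j (Units.mk0 (2 : K) h2))
  rw [key, key] at hj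
  have hq : ((2 : ℚ) ^ m j : ℚ) = 2 ^ m' j := by
    have : (((2 : ℚ) ^ m j : ℚ) : K) = ((2 ^ m' j : ℚ) : K) := by
      push_cast
      exact hj
    exact_mod_cast this
  exact zpow_right_injective₀ (by norm_num) (by norm_num) hq

/-- The characters of a torus are linearly independent, also with vector coefficients. -/
theorem eq_zero_of_sum_character_smul [CharZero K] {W : Type*} [AddCommGroup W] [Module K W]
    {S : Finset (Fin r → ℤ)} {g : (Fin r → ℤ) → W}
    (h : ∀ t : Fin r → Kˣ, ∑ m ∈ S, (character m t : K) • g m = 0) : ∀ m ∈ S, g m = 0 := by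
  intro m hm
  refine (Module.forall_dual_apply_eq_zero_iff K (g m)).1 fun φ => ?_
  let χ : (Fin r → ℤ) → (Fin r → Kˣ) →* K := fun m =>
    { toFun := character m, map_one' := character_one m, map_mul' := character_mul m }
  have hχ : Function.Injective χ := fun m m' hmm =>
    character_injective (congrArg DFunLike.coe hmm)
  refine linearIndependent_iff'.1 ((linearIndependent_monoidHom (Fin r → Kˣ) K).comp χ hχ) S
    (fun m => φ (g m)) (funext fun t => ?_) m hm
  have := congrArg φ (h t)
  simp only [map_sum, map_smul, smul_eq_mul, map_zero] at this
  simp only [Function.comp_apply, Finset.sum_apply, Pi.smul_apply, smul_eq_mul, Pi.zero_apply]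
  rw [← this]
  exact Finset.sum_congr rfl fun m _ => mul_comm _ _

theorem sum_filter_eq_zero_of_sum_character_smul [CharZero K] {W ι : Type*} [AddCommGroup W]
    [Module K W] {S : Finset ι} {g : ι → W} {wt : ι → Fin r → ℤ}
    (h : ∀ t : Fin r → Kˣ, ∑ d ∈ S, (character (wt d) t : K) • g d = 0) (m : Fin r → ℤ) :
    ∑ d ∈ S with wt d = m, g d = 0 := by
  classical
  by_cases hm : m ∈ S.image wt
  · refine eq_zero_of_sum_character_smul (K := K) (S := S.image wt)
      (g := fun m => ∑ d ∈ S with wt d = m, g d) (fun t => ?_) m hm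
    rw [← h t, ← Finset.sum_fiberwise_of_maps_to (t := S.image wt) (g := wt)
      (fun d hd => Finset.mem_image_of_mem _ hd)]
    refine Finset.sum_congr rfl fun m _ => ?_
    rw [Finset.smul_sum]
    exact Finset.sum_congr rfl fun d hd => by rw [(Finset.mem_filter.1 hd).2]
  · refine Finset.sum_eq_zero fun d hd => ?_
    rw [Finset.mem_filter] at hd
    exact (hm (hd.2 ▸ Finset.mem_image_of_mem wt hd.1)).elim

end Characters

/-! ### Weight vectors and the differential -/

section Representation

variable {K : Type*} [Field K] [CharZero K] {r : ℕ} {V : Type*} [AddCommGroup V] [Module K V]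
  {ρ : Representation K (Fin r → Kˣ) V}

/-- Independence of characters lets coefficients be compared, so whichever Laurent expansion is
chosen, the differential acts on weight vectors in the expected way. -/
theorem coefficient_apply_of_weight {P : (Fin r → ℤ) →₀ Module.End K V}
    (hP : ∀ t, ρ t = P.sum fun m A => character m t • A) {m : Fin r → ℤ} {v : V}
    (hv : ∀ t, ρ t v = (character m t : K) • v) (m' : Fin r → ℤ) :
    P m' v = if m' = m then v else 0 := by
  classical
  have key : ∀ m' ∈ insert m P.support, P m' v - (if m' = m then v else 0) = 0 := by
    refine eq_zero_of_sum_character_smul (K := K) fun t => ?_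
    simp_rw [smul_sub]
    rw [Finset.sum_sub_distrib]
    have h := hv t
    rw [hP t, Finsupp.sum_of_support_subset P (Finset.subset_insert m P.support) _ (by simp),
      LinearMap.sum_apply] at h
    simp only [LinearMap.smul_apply] at h
    rw [h]
    simp
  by_cases hm : m' ∈ insert m P.support
  · exact sub_eq_zero.1 (key m' hm)
  · rw [Finset.mem_insert, not_or, Finsupp.notMem_support_iff] at hm
    simp [hm.1, hm.2]

theorem differential_apply_of_weight (hρ : IsAlgebraic ρ) {m : Fin r → ℤ} {v : V}
    (hv : ∀ t, ρ t v = (character m t : K) • v) (ξ : Fin r → K) :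
    differential ρ hρ ξ v = characterDiff K m ξ • v := by
  classical
  rw [differential, Finsupp.sum_of_support_subset hρ.choose
    (Finset.subset_insert m hρ.choose.support) _ (by intro i _; ext; simp)]
  simp only [LinearMap.sum_apply, LinearMap.smulRight_apply, LinearMap.smul_apply,
    coefficient_apply_of_weight hρ.choose_spec hv]
  simp

/-- An algebraic representation of a torus is spanned by weight vectors. -/
theorem span_weightVectors (hρ : IsAlgebraic ρ) :
    Submodule.span K {v : V | ∃ m : Fin r → ℤ, ∀ t, ρ t v = (character m t : K) • v} = ⊤ := by
  obtain ⟨P, hP⟩ := hρ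
  have hP' : ∀ t v, ρ t v = ∑ m ∈ P.support, (character m t : K) • P m v := fun t v => by
    rw [hP t, Finsupp.sum, LinearMap.sum_apply]
    rfl
  refine eq_top_iff.2 fun v _ => ?_
  have hv : v = ∑ m ∈ P.support, P m v := by
    have := hP' 1 v
    rw [map_one] at this
    simpa [character_one] using this
  rw [hv]
  refine Submodule.sum_mem _ fun m hm => Submodule.subset_span ⟨m, fun t => ?_⟩
  -- Each `P m v` is a weight vector: compare the coefficients of `ρ (t * u) v = ρ t (ρ u v)` as
  -- functions of `u`.
  refine sub_eq_zero.1 (eq_zero_of_sum_character_smul (K := K) (S := P.support)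
    (g := fun m => ρ t (P m v) - (character m t : K) • P m v) (fun u => ?_) m hm)
  simp_rw [smul_sub]
  rw [Finset.sum_sub_distrib, sub_eq_zero]
  have h1 : ρ (t * u) v = ρ t (ρ u v) := by rw [map_mul]; rfl
  rw [hP' (t * u), hP' u, map_sum] at h1
  simp_rw [map_smul, character_mul, mul_comm (character _ t : K), mul_smul] at h1
  exact h1.symm

theorem exists_isWeightBasis [FiniteDimensional K V] (hρ : IsAlgebraic ρ) :
    ∃ (b : Module.Basis (Fin (Module.finrank K V)) K V)
      (s : Fin (Module.finrank K V) → Fin r → ℤ), IsWeightBasis ρ b s := by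
  let b := Module.Basis.ofSpan (span_weightVectors hρ).ge
  have hb : ∀ i, ∃ m : Fin r → ℤ, ∀ t, ρ t (b i) = (character m t : K) • b i := fun i =>
    Module.Basis.ofSpan_subset (span_weightVectors hρ).ge ⟨i, rfl⟩
  have := Module.Finite.finite_basis b
  have := Fintype.ofFinite
    ((linearIndepOn_empty K id).extend (Set.empty_subset
      {v : V | ∃ m : Fin r → ℤ, ∀ t, ρ t v = (character m t : K) • v}))
  let ε := Fintype.equivFinOfCardEq (Module.finrank_eq_card_basis b).symm
  choose m hm using hb
  refine ⟨b.reindex ε, fun i => m (ε.symm i), fun t i => ?_⟩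
  rw [Module.Basis.reindex_apply, hm]

end Representation

/-! ### Nilpotent vectors, invariant polynomials and visibility -/

section PolynomialFunctions

variable {K : Type*} [Field K] {r n : ℕ} {V : Type*} [AddCommGroup V] [Module K V]
  {ρ : Representation K (Fin r → Kˣ) V} {b : Module.Basis (Fin n) K V} {s : Fin n → Fin r → ℤ}

theorem coord_mem_polyFun (b : Module.Basis (Fin n) K V) (i : Fin n) :
    (fun v => b.repr v i) ∈ polyFun K V :=
  Algebra.subset_adjoin ⟨b.coord i, funext fun v => b.coord_apply i v⟩

theorem exists_eval_of_mem_polyFun (b : Module.Basis (Fin n) K V) {f : V → K}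
    (hf : f ∈ polyFun K V) :
    ∃ p : MvPolynomial (Fin n) K, ∀ v, f v = MvPolynomial.eval (b.repr v) p := by
  induction hf using Algebra.adjoin_induction with
  | mem f hf =>
    obtain ⟨φ, rfl⟩ := hf
    refine ⟨∑ i, MvPolynomial.C (φ (b i)) * MvPolynomial.X i, fun v => ?_⟩
    conv_lhs => rw [← b.sum_repr v]
    simp only [map_sum, map_smul, smul_eq_mul, map_mul, MvPolynomial.eval_C, MvPolynomial.eval_X]
    exact Finset.sum_congr rfl fun i _ => mul_comm _ _
  | algebraMap a => exact ⟨MvPolynomial.C a, fun v => by simp⟩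
  | add f g _ _ hf hg =>
    obtain ⟨p, hp⟩ := hf
    obtain ⟨q, hq⟩ := hg
    exact ⟨p + q, fun v => by simp [hp, hq]⟩
  | mul f g _ _ hf hg =>
    obtain ⟨p, hp⟩ := hf
    obtain ⟨q, hq⟩ := hg
    exact ⟨p * q, fun v => by simp [hp, hq]⟩

theorem IsWeightBasis.repr_apply (hb : IsWeightBasis ρ b s) (t : Fin r → Kˣ) (v : V) (i : Fin n) :
    b.repr (ρ t v) i = character (s i) t * b.repr v i := by
  have : b.coord i ∘ₗ ρ t = (character (s i) t : K) • b.coord i := by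
    refine b.ext fun k => ?_
    simp only [LinearMap.comp_apply, hb t k, map_smul, LinearMap.smul_apply, Module.Basis.coord_apply,
      Module.Basis.repr_self, smul_eq_mul]
    by_cases h : k = i
    · rw [h]
    · simp [h]
  simpa using LinearMap.congr_fun this v

theorem IsWeightBasis.eval_apply (hb : IsWeightBasis ρ b s) (p : MvPolynomial (Fin n) K)
    (t : Fin r → Kˣ) (v : V) :
    MvPolynomial.eval (b.repr (ρ t v)) p = ∑ d ∈ p.support,
      (character (∑ i, (d i : ℤ) • s i) t : K) • (p.coeff d * ∏ i, b.repr v i ^ d i) := by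
  rw [MvPolynomial.eval_eq']
  refine Finset.sum_congr rfl fun d _ => ?_
  simp only [hb.repr_apply, mul_pow, Finset.prod_mul_distrib, character_sum_zsmul, zpow_natCast,
    smul_eq_mul]
  ring

variable [CharZero K]

/-- A vector is nilpotent if there is no nontrivial relation with natural coefficients between the
weights in its support. -/
theorem IsWeightBasis.isNilpotentVec (hb : IsWeightBasis ρ b s) {x : V}
    (hx : ∀ a : Fin n → ℕ, ∑ i, (a i : ℤ) • s i = 0 → (∀ i, b.repr x i = 0 → a i = 0) → a = 0) :
    IsNilpotentVec ρ x := by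
  classical
  intro f hf hvan
  obtain ⟨p, hp⟩ := exists_eval_of_mem_polyFun b hf
  -- If `f` vanishes on the orbit of `x`, its weight-zero part vanishes at `x`. By hypothesis only
  -- the constant monomial contributes there, so `f 0 = 0`.
  have h0 := sum_filter_eq_zero_of_sum_character_smul (K := K) (S := p.support)
    (g := fun d => p.coeff d * ∏ i, b.repr x i ^ d i) (wt := fun d => ∑ i, (d i : ℤ) • s i)
    (fun t => by rw [← hb.eval_apply, ← hp]; exact hvan _ ⟨t, rfl⟩) 0
  rw [Finset.sum_eq_single 0] at h0
  · rw [hp, map_zero, Finsupp.coe_zero, MvPolynomial.eval_zero]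
    simpa [MvPolynomial.constantCoeff_eq] using h0
  · intro d hd hd0
    rw [Finset.mem_filter] at hd
    obtain ⟨i, hi, hdi⟩ : ∃ i, b.repr x i = 0 ∧ d i ≠ 0 := by
      by_contra! h
      exact hd0 (DFunLike.coe_injective (hx d hd.2 h))
    rw [Finset.prod_eq_zero (Finset.mem_univ i) (by rw [hi, zero_pow hdi]), mul_zero]
  · intro h
    have : p.coeff 0 = 0 := by simpa using h
    simp [this]

theorem IsWeightBasis.coeff_eq_zero_of_mem_invariants (hb : IsWeightBasis ρ b s)
    {p : MvPolynomial (Fin n) K}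
    (hp : ∀ t v, MvPolynomial.eval (b.repr (ρ t v)) p = MvPolynomial.eval (b.repr v) p)
    {d : Fin n →₀ ℕ} (hd : p.coeff d ≠ 0) : ∑ i, (d i : ℤ) • s i = 0 := by
  classical
  refine character_injective (K := K) (funext fun t => ?_)
  rw [character_zero]
  let q : MvPolynomial (Fin n) K := ∑ d ∈ p.support, MvPolynomial.monomial d
    (((character (∑ i, (d i : ℤ) • s i) t : K) - 1) * p.coeff d)
  have hq : q = 0 := by
    refine MvPolynomial.funext fun x => ?_
    have h := hp t (b.equivFun.symm x)
    have hx : ∀ i, b.repr (b.equivFun.symm x) i = x i := fun i =>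
      congrFun (b.equivFun.apply_symm_apply x) i
    rw [hb.eval_apply, MvPolynomial.eval_eq', ← sub_eq_zero, ← Finset.sum_sub_distrib] at h
    simp only [hx, smul_eq_mul] at h
    rw [map_zero, ← h, map_sum]
    refine Finset.sum_congr rfl fun d _ => ?_
    rw [MvPolynomial.eval_monomial, Finsupp.prod_fintype _ _ (by simp)]
    ring
  have hc : q.coeff d = ((character (∑ i, (d i : ℤ) • s i) t : K) - 1) * p.coeff d := by
    simp only [q, MvPolynomial.coeff_sum, MvPolynomial.coeff_monomial, Finset.sum_ite_eq']
    rw [if_pos (MvPolynomial.mem_support_iff.2 hd)]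
  rw [hq, MvPolynomial.coeff_zero, eq_comm, mul_eq_zero] at hc
  exact sub_eq_zero.1 (hc.resolve_right hd)

/-- For a visible representation, every nontrivial relation between the weights dominates a
nontrivial relation with nonnegative coefficients. -/
theorem IsVisible.exists_nonneg_relation (hvis : IsVisible ρ) (hb : IsWeightBasis ρ b s)
    (d : Fin n → ℚ) (hd : ∑ i, d i • ratWeight (s i) = 0) (hd0 : d ≠ 0) :
    ∃ e : Fin n → ℚ, ∑ i, e i • ratWeight (s i) = 0 ∧ e ≠ 0 ∧ 0 ≤ e ∧ ∀ i, d i = 0 → e i = 0 := by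
  classical
  by_contra hcon
  obtain ⟨N, hN, a, ha⟩ := exists_int_multiple d
  have hN' : (N : ℚ) ≠ 0 := by exact_mod_cast hN.ne'
  have hrel : ∑ i, a i • s i = 0 := by
    rw [← sum_smul_ratWeight_eq_zero_iff]
    simp_rw [ha, mul_smul]
    rw [← Finset.smul_sum, hd, smul_zero]
  obtain ⟨i₀, hi₀⟩ : ∃ i, d i ≠ 0 := Function.ne_iff.1 hd0
  have ha₀ : a i₀ ≠ 0 := by
    have : (a i₀ : ℚ) ≠ 0 := by rw [ha]; exact mul_ne_zero hN' hi₀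
    exact_mod_cast this
  -- Vectors with the support of `d`, differing only at `i₀`, where the Laurent monomial with
  -- exponents `a` takes the value `2 ^ (k * a i₀)`.
  let c : ℕ → Fin n → K := fun k i => if d i = 0 then 0 else if i = i₀ then 2 ^ k else 1
  let x : ℕ → V := fun k => b.equivFun.symm (c k)
  have hx : ∀ k i, b.repr (x k) i = c k i := fun k i =>
    congrFun (b.equivFun.apply_symm_apply (c k)) i
  have hnil : ∀ k, IsNilpotentVec ρ (x k) := by
    refine fun k => hb.isNilpotentVec fun e he hsupp => ?_
    by_contra he0
    refine hcon ⟨fun i => ((e i : ℤ) : ℚ), (sum_smul_ratWeight_eq_zero_iff _ _).2 he, ?_, ?_, ?_⟩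
    · intro h
      refine he0 (funext fun i => ?_)
      simpa using congrFun h i
    · intro i
      simp
    · intro i hi
      simp [hsupp i (by rw [hx]; simp [c, hi])]
  have hinj : Function.Injective fun k => orbit ρ (x k) := by
    intro k k' h
    have hmem : x k' ∈ orbit ρ (x k) := by
      simp only at h
      rw [h]
      exact ⟨1, by simp⟩
    obtain ⟨t, ht⟩ := hmem
    have hcoord : ∀ i, (character (s i) t : K) * c k i = c k' i := fun i => by
      rw [← hx k, ← hx k', ← hb.repr_apply]
      exact congrArg (fun v => b.repr v i) ht
    have hprod : ∏ i, (character (s i) t : K) ^ a i = 1 := by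
      rw [← character_sum_zsmul, hrel, character_zero]
    rw [Finset.prod_eq_single i₀] at hprod
    · have h1 := hcoord i₀
      simp only [c, if_neg hi₀, if_true] at h1
      have h2 : ((2 : K) ^ k) ^ a i₀ = (2 ^ k') ^ a i₀ := by
        rw [← h1, mul_zpow, hprod, one_mul]
      rw [← zpow_natCast, ← zpow_natCast, ← zpow_mul, ← zpow_mul] at h2
      have h3 : ((2 : ℚ) ^ ((k : ℤ) * a i₀)) = 2 ^ ((k' : ℤ) * a i₀) := by
        have : (((2 : ℚ) ^ ((k : ℤ) * a i₀) : ℚ) : K) = ((2 ^ ((k' : ℤ) * a i₀) : ℚ) : K) := by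
          push_cast
          exact h2
        exact_mod_cast this
      have h4 := zpow_right_injective₀ (by norm_num) (by norm_num) h3
      exact_mod_cast mul_right_cancel₀ ha₀ h4
    · intro i _ hi
      by_cases hdi : d i = 0
      · have : a i = 0 := by
          have : (a i : ℚ) = 0 := by rw [ha, hdi, mul_zero]
          exact_mod_cast this
        rw [this, zpow_zero]
      · have h1 := hcoord i
        simp only [c, if_neg hdi, if_neg hi, mul_one] at h1
        rw [h1, one_zpow]
    · simp
  refine Set.infinite_of_injective_forall_mem hinj (fun k => ?_) hvis
  exact ⟨x k, hnil k, rfl⟩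

end PolynomialFunctions

/-! ### The Cartan subspace -/

section Cartan

variable {K : Type*} [Field K] {r n l : ℕ} {V : Type*} [AddCommGroup V] [Module K V]
  {ρ : Representation K (Fin r → Kˣ) V} {b : Module.Basis (Fin n) K V} {s : Fin n → Fin r → ℤ}
  {I : Fin (l + 1) → Finset (Fin n)} {e : Fin n → ℚ}

theorem characterDiff_apply (m : Fin r → ℤ) (ξ : Fin r → K) :
    characterDiff K m ξ = ∑ k, (m k : K) * ξ k := by
  simp [characterDiff]

theorem characterDiff_single (m : Fin r → ℤ) (k : Fin r) :
    characterDiff K m (Pi.single k 1) = (m k : K) := by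
  simp [characterDiff_apply, Pi.single_apply]

theorem IsCircuitPartition.repr_blockMap_zero (h : IsCircuitPartition s l I e) (w : Fin l → K)
    {i : Fin n} (hi : i ∈ I 0) : b.repr (blockMap b I w) i = 0 := by
  classical
  have hne : ∀ j : Fin l, i ∉ I j.succ := fun j hj =>
    j.succ_ne_zero ((h.partition i).unique hj hi)
  simp [blockMap, Fintype.linearCombination_apply, Finsupp.single_apply, hne]

theorem IsCircuitPartition.repr_blockMap_succ (h : IsCircuitPartition s l I e) (w : Fin l → K)
    {i : Fin n} {j : Fin l} (hi : i ∈ I j.succ) : b.repr (blockMap b I w) i = w j := by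
  classical
  have hne : ∀ k : Fin l, i ∈ I k.succ ↔ k = j := fun k =>
    ⟨fun hk => Fin.succ_injective l ((h.partition i).unique hk hi), fun hk => hk ▸ hi⟩
  simp [blockMap, Fintype.linearCombination_apply, Finsupp.single_apply, hne]

theorem IsCircuitPartition.blockMap_injective (h : IsCircuitPartition s l I e) :
    Function.Injective (blockMap b I) := by
  intro w w' hw
  ext j
  obtain ⟨i, hi⟩ := h.nonempty j.succ j.succ_ne_zero
  rw [← h.repr_blockMap_succ (b := b) w hi, hw, h.repr_blockMap_succ w' hi]

theorem IsCircuitPartition.finrank_range_blockMap (h : IsCircuitPartition s l I e) :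
    Module.finrank K (LinearMap.range (blockMap b I)) = l := by
  rw [LinearMap.finrank_range_of_inj h.blockMap_injective, Module.finrank_fin_fun]

variable [CharZero K]

theorem IsWeightBasis.repr_differential_apply (hb : IsWeightBasis ρ b s) (hρ : IsAlgebraic ρ)
    (ξ : Fin r → K) (v : V) (i : Fin n) :
    b.repr (differential ρ hρ ξ v) i = characterDiff K (s i) ξ * b.repr v i := by
  have : b.coord i ∘ₗ differential ρ hρ ξ = characterDiff K (s i) ξ • b.coord i := by
    refine b.ext fun k => ?_
    simp only [LinearMap.comp_apply, differential_apply_of_weight hρ (fun t => hb t k), map_smul,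
      LinearMap.smul_apply, Module.Basis.coord_apply, Module.Basis.repr_self, smul_eq_mul]
    by_cases h : k = i
    · rw [h]
    · simp [h]
  simpa using LinearMap.congr_fun this v

theorem IsWeightBasis.mem_cartanCandidate_iff (hb : IsWeightBasis ρ b s) (hρ : IsAlgebraic ρ)
    {v x : V} : x ∈ cartanCandidate ρ hρ v ↔ ∀ ξ : Fin r → K, ∃ η : Fin r → K, ∀ i,
      characterDiff K (s i) η * b.repr v i = characterDiff K (s i) ξ * b.repr x i := by
  change lieOrbit ρ hρ x ≤ lieOrbit ρ hρ v ↔ _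
  rw [lieOrbit, LinearMap.range_le_iff_comap, Submodule.eq_top_iff']
  refine forall_congr' fun ξ => exists_congr fun η => ?_
  rw [← b.repr.injective.eq_iff, Finsupp.ext_iff]
  refine forall_congr' fun i => ?_
  rw [LinearMap.flip_apply, LinearMap.flip_apply, hb.repr_differential_apply,
    hb.repr_differential_apply]

theorem IsCircuitPartition.sum_block_cast (h : IsCircuitPartition s l I e) (j : Fin l)
    (k : Fin r) : ∑ i ∈ I j.succ, (e i : K) * (s i k : K) = 0 := by
  have := congrFun (h.rel j.succ j.succ_ne_zero) k
  simp only [Finset.sum_apply, Pi.smul_apply, ratWeight, smul_eq_mul, Pi.zero_apply] at this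
  exact_mod_cast congrArg (Rat.cast : ℚ → K) this

theorem IsCircuitPartition.sum_block_characterDiff (h : IsCircuitPartition s l I e) (j : Fin l)
    (ξ : Fin r → K) : ∑ i ∈ I j.succ, (e i : K) * characterDiff K (s i) ξ = 0 := by
  simp_rw [characterDiff_apply, Finset.mul_sum]
  rw [Finset.sum_comm]
  refine Finset.sum_eq_zero fun k _ => ?_
  simp_rw [← mul_assoc]
  rw [← Finset.sum_mul, h.sum_block_cast, zero_mul]

theorem IsCircuitPartition.range_blockMap (h : IsCircuitPartition s l I e)
    (hb : IsWeightBasis ρ b s) (hρ : IsAlgebraic ρ) :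
    LinearMap.range (blockMap b I) = cartanCandidate ρ hρ (blockMap b I fun _ => 1) := by
  classical
  apply le_antisymm
  · rintro _ ⟨w, rfl⟩
    refine (hb.mem_cartanCandidate_iff hρ).2 fun ξ => ?_
    let M : (Fin r → K) →ₗ[K] (Fin n → K) := LinearMap.pi fun i => characterDiff K (s i)
    let y : Fin n → K := fun i => characterDiff K (s i) ξ * b.repr (blockMap b I w) i
    -- By duality `y` lies in the image of `𝔱` once every linear form vanishing on that image kills
    -- `y`. Such a form is a relation over `K`, hence a multiple of `e` on each block, where `y` is
    -- `w j` times the weights at `ξ`.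
    have hy : y ∈ LinearMap.range M := by
      by_contra hy
      obtain ⟨f, hfy, hf⟩ := Submodule.exists_le_ker_of_notMem hy
      have hsum : ∀ z, f z = ∑ i, f (Pi.single i 1) * z i := fun z => by
        conv_lhs => rw [pi_eq_sum_univ' z]
        simp [mul_comm, Pi.single]
      obtain ⟨-, hprop⟩ := h.zero_and_proportional_of_charZero (K := K)
        (d := fun i => f (Pi.single i 1)) fun k => by
          have : f (M (Pi.single k 1)) = 0 := hf ⟨_, rfl⟩
          rw [hsum] at this
          simpa only [M, LinearMap.pi_apply, characterDiff_single] using this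
      refine hfy ?_
      rw [hsum, sum_eq_sum_blocks h.partition, Fin.sum_univ_succ,
        Finset.sum_eq_zero fun i hi => ?_, zero_add]
      · refine Finset.sum_eq_zero fun j _ => ?_
        obtain ⟨c, hc⟩ := hprop j
        rw [← mul_zero (c * w j), ← h.sum_block_characterDiff j ξ, Finset.mul_sum]
        refine Finset.sum_congr rfl fun i hi => ?_
        simp only [y]
        rw [h.repr_blockMap_succ w hi, hc i hi]
        ring
      · simp only [y]
        rw [h.repr_blockMap_zero w hi, mul_zero, mul_zero]
    obtain ⟨η, hη⟩ := hy
    refine ⟨η, fun i => ?_⟩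
    have hηi : characterDiff K (s i) η = y i := congrFun hη i
    rw [hηi]
    obtain ⟨j, hj, -⟩ := h.partition i
    refine Fin.cases (fun hj => ?_) (fun j hj => ?_) j hj
    · simp only [y]
      rw [h.repr_blockMap_zero _ hj, h.repr_blockMap_zero _ hj, mul_zero, mul_zero]
    · rw [h.repr_blockMap_succ _ hj, mul_one]
  · intro x hx
    rw [hb.mem_cartanCandidate_iff hρ] at hx
    have hblock : ∀ j : Fin l, ∃ c, ∀ i ∈ I j.succ, b.repr x i = c := by
      intro j
      -- Pairing the membership condition with `e` on block `j` makes `e i * x_i` a relation over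
      -- `K`. It is proportional to `e`, so `x_i` is constant on the block.
      obtain ⟨-, hprop⟩ := h.zero_and_proportional_of_charZero (K := K)
        (d := fun i => if i ∈ I j.succ then e i * b.repr x i else 0) fun k => by
          obtain ⟨η, hη⟩ := hx (Pi.single k 1)
          simp only [ite_mul, zero_mul, Finset.sum_ite_mem, Finset.univ_inter]
          rw [← h.sum_block_characterDiff j η]
          refine Finset.sum_congr rfl fun i hi => ?_
          have := hη i
          rw [h.repr_blockMap_succ _ hi, mul_one, characterDiff_single] at this
          rw [this]
          ring
      obtain ⟨c, hc⟩ := hprop j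
      refine ⟨c, fun i hi => ?_⟩
      have := hc i hi
      have he : (e i : K) ≠ 0 := by exact_mod_cast (h.pos _ j.succ_ne_zero i hi).ne'
      rw [if_pos hi, mul_comm] at this
      exact mul_right_cancel₀ he this
    choose w hw using hblock
    refine ⟨w, b.repr.injective (Finsupp.ext fun i => ?_)⟩
    obtain ⟨j, hj, -⟩ := h.partition i
    refine Fin.cases (fun hj => ?_) (fun j hj => ?_) j hj
    · rw [h.repr_blockMap_zero _ hj]
      -- A zero weight at `i` would be a relation not vanishing at `i`, which is impossible on `I
      -- 0`.
      obtain ⟨k, hk⟩ : ∃ k, s i k ≠ 0 := by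
        by_contra! hs
        have := h.zero (Pi.single i 1) (by
          rw [Finset.sum_eq_single i]
          · ext k
            simp [ratWeight, hs k]
          · intro i' _ hi'
            simp [hi']
          · simp) i hj
        simp at this
      obtain ⟨η, hη⟩ := hx (Pi.single k 1)
      have := hη i
      rw [h.repr_blockMap_zero _ hj, mul_zero, characterDiff_single, eq_comm, mul_eq_zero] at this
      exact (this.resolve_left (by exact_mod_cast hk)).symm
    · rw [h.repr_blockMap_succ _ hj, hw j i hj]

end Cartan

/-! ### The algebra of invariants and its dimension -/

section Quotient

variable {K : Type*} [Field K] {r n l : ℕ} {V : Type*} [AddCommGroup V] [Module K V]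
  {ρ : Representation K (Fin r → Kˣ) V} {b : Module.Basis (Fin n) K V} {s : Fin n → Fin r → ℤ}
  {I : Fin (l + 1) → Finset (Fin n)} {e : Fin n → ℚ}

/-- The monomial `∏ i ∈ I (j + 1), x_i ^ c_i` in the coordinates of the `j`-th block. -/
noncomputable def blockMonomial (b : Module.Basis (Fin n) K V) (I : Fin (l + 1) → Finset (Fin n))
    (c : Fin n → ℕ) (j : Fin l) : V → K :=
  fun v => ∏ i ∈ I j.succ, b.repr v i ^ c i

theorem aeval_blockMonomial_apply (b : Module.Basis (Fin n) K V)
    (I : Fin (l + 1) → Finset (Fin n)) (c : Fin n → ℕ) (p : MvPolynomial (Fin l) K) (v : V) :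
    MvPolynomial.aeval (blockMonomial b I c) p v =
      MvPolynomial.eval (fun j => blockMonomial b I c j v) p := by
  induction p using MvPolynomial.induction_on with
  | C a => simp
  | add p q hp hq => simp [hp, hq]
  | mul_X p j hp => simp [hp]

theorem IsWeightBasis.blockMonomial_mem_invariants (hb : IsWeightBasis ρ b s) {c : Fin n → ℕ}
    {j : Fin l} (hc : ∑ i ∈ I j.succ, (c i : ℤ) • s i = 0) :
    blockMonomial b I c j ∈ invariants ρ := by
  refine ⟨?_, fun t v => ?_⟩
  · have : blockMonomial b I c j = ∏ i ∈ I j.succ, (fun v => b.repr v i) ^ c i := by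
      ext v
      simp [blockMonomial]
    rw [this]
    exact Subalgebra.prod_mem _ fun i _ => Subalgebra.pow_mem _ (coord_mem_polyFun b i) _
  · have h1 : ∏ i ∈ I j.succ, (character (s i) t : K) ^ c i = 1 := by
      rw [← character_zero t, ← hc, character_sum_zsmul]
      simp only [zpow_natCast]
    simp only [blockMonomial, hb.repr_apply, mul_pow, Finset.prod_mul_distrib, h1, one_mul]

/-- The block monomials are algebraically independent because they map `V` onto `K^l`: on `x(u)` the
`j`-th one is a positive power of `u j`, and roots exist in `K`. -/
theorem IsCircuitPartition.aeval_blockMonomial_injective [IsAlgClosed K]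
    (h : IsCircuitPartition s l I e) {c : Fin n → ℕ}
    (hc : ∀ j : Fin l, ∀ i ∈ I j.succ, 0 < c i) :
    Function.Injective (MvPolynomial.aeval (R := K) (blockMonomial b I c)) := by
  intro p q hpq
  have : Infinite K := IsAlgClosed.instInfinite
  refine MvPolynomial.funext fun y => ?_
  have hroot : ∀ j : Fin l, ∃ u : K, u ^ (∑ i ∈ I j.succ, c i) = y j := fun j =>
    IsAlgClosed.exists_pow_nat_eq (y j)
      (Finset.sum_pos (hc j) (h.nonempty j.succ j.succ_ne_zero))
  choose u hu using hroot
  have hval : (fun j => blockMonomial b I c j (blockMap b I u)) = y := by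
    ext j
    rw [← hu j, ← Finset.prod_pow_eq_pow_sum]
    exact Finset.prod_congr rfl fun i hi => by rw [h.repr_blockMap_succ u hi]
  have := congrFun hpq (blockMap b I u)
  rwa [aeval_blockMonomial_apply, aeval_blockMonomial_apply, hval] at this

variable [CharZero K]

/-- Every monomial of an invariant polynomial has an exponent vector that is a relation, hence is a
product of powers of the primitive block monomials. These are algebraically independent, so the
invariants form a polynomial ring in `l` variables. -/
theorem IsCircuitPartition.quotientDim_eq [IsAlgClosed K] (h : IsCircuitPartition s l I e)
    (hb : IsWeightBasis ρ b s) : quotientDim ρ = (l : WithBot ℕ∞) := by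
  obtain ⟨c, hpos, hrel, hprop⟩ := h.exists_primitive
  have hrange : invariants ρ = (MvPolynomial.aeval (R := K) (blockMonomial b I c)).range := by
    apply le_antisymm
    · intro f hf
      obtain ⟨p, hp⟩ := exists_eval_of_mem_polyFun b hf.1
      have hf' : f = ∑ d ∈ p.support, p.coeff d • fun v => ∏ i, b.repr v i ^ d i := by
        ext v
        rw [hp, MvPolynomial.eval_eq', Finset.sum_apply]
        rfl
      rw [hf']
      refine Subalgebra.sum_mem _ fun d hd => Subalgebra.smul_mem _ ?_ _
      obtain ⟨hzero, k, hk⟩ := hprop d (hb.coeff_eq_zero_of_mem_invariants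
        (fun t v => by rw [← hp, ← hp]; exact hf.2 t v) (MvPolynomial.mem_support_iff.1 hd))
      refine ⟨∏ j, MvPolynomial.X j ^ k j, ?_⟩
      ext v
      change MvPolynomial.aeval (blockMonomial b I c) _ v = _
      rw [aeval_blockMonomial_apply, map_prod]
      simp only [map_pow, MvPolynomial.eval_X, blockMonomial, ← Finset.prod_pow, ← pow_mul]
      have hblocks : ∏ i, b.repr v i ^ d i = ∏ j, ∏ i ∈ I j, b.repr v i ^ d i :=
        sum_eq_sum_blocks h.partition fun i => Additive.ofMul (b.repr v i ^ d i)
      have hone : ∏ i ∈ I 0, b.repr v i ^ d i = 1 :=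
        Finset.prod_eq_one fun i hi => by rw [hzero i hi, pow_zero]
      rw [hblocks, Fin.prod_univ_succ, hone, one_mul]
      refine Finset.prod_congr rfl fun j _ => Finset.prod_congr rfl fun i hi => ?_
      rw [hk j i hi, mul_comm]
    · rintro _ ⟨p, rfl⟩
      change MvPolynomial.aeval (blockMonomial b I c) p ∈ _
      induction p using MvPolynomial.induction_on with
      | C a =>
        rw [MvPolynomial.aeval_C]
        exact Subalgebra.algebraMap_mem _ a
      | add p q hp hq =>
        rw [map_add]
        exact Subalgebra.add_mem _ hp hq
      | mul_X p j hp =>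
        rw [map_mul, MvPolynomial.aeval_X]
        exact Subalgebra.mul_mem _ hp (hb.blockMonomial_mem_invariants (hrel j))
  rw [quotientDim, hrange, ← ringKrullDim_eq_of_ringEquiv
    (AlgEquiv.ofInjective _ (h.aeval_blockMonomial_injective (b := b) hpos)).toRingEquiv,
    MvPolynomial.ringKrullDim_of_isNoetherianRing, ringKrullDim_eq_zero_of_field, zero_add,
    Nat.card_fin]

end Quotient

end TorusRep

theorem mainTheorem9 {K : Type*} [Field K] [IsAlgClosed K] [CharZero K]
    {V : Type*} [AddCommGroup V] [Module K V] [FiniteDimensional K V] {r : ℕ}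
    (ρ : Representation K (Fin r → Kˣ) V) (hρ : TorusRep.IsAlgebraic ρ)
    (hvis : TorusRep.IsVisible ρ) :
    TorusRep.IsPolar ρ hρ ∧
    (∃ (b : Module.Basis (Fin (Module.finrank K V)) K V)
      (s : Fin (Module.finrank K V) → Fin r → ℤ), TorusRep.IsWeightBasis ρ b s) ∧
    ∀ (n : ℕ) (b : Module.Basis (Fin n) K V) (s : Fin n → Fin r → ℤ),
      TorusRep.IsWeightBasis ρ b s →
      (∃ (l : ℕ) (I : Fin (l + 1) → Finset (Fin n)), TorusRep.IsBlockPartition s l I) ∧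
      ∀ (l : ℕ) (I : Fin (l + 1) → Finset (Fin n)), TorusRep.IsBlockPartition s l I →
        LinearMap.range (TorusRep.blockMap b I) =
          TorusRep.cartanCandidate ρ hρ (TorusRep.blockMap b I fun _ => 1) ∧
        TorusRep.IsCartanSubspace ρ hρ (LinearMap.range (TorusRep.blockMap b I)) ∧
        Module.finrank K (LinearMap.range (TorusRep.blockMap b I)) = l ∧
        TorusRep.quotientDim ρ = (l : WithBot ℕ∞) := by
  have hexists : ∀ (n : ℕ) (b : Module.Basis (Fin n) K V) (s : Fin n → Fin r → ℤ),
      TorusRep.IsWeightBasis ρ b s →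
      ∃ (l : ℕ) (I : Fin (l + 1) → Finset (Fin n)) (e : Fin n → ℚ),
        TorusRep.IsCircuitPartition s l I e := fun n b s hb =>
    TorusRep.exists_isCircuitPartition (hvis.exists_nonneg_relation hb)
  have hdim : ∀ {n : ℕ} {b : Module.Basis (Fin n) K V} {s : Fin n → Fin r → ℤ},
      TorusRep.IsWeightBasis ρ b s →
      ∀ {l : ℕ} {I : Fin (l + 1) → Finset (Fin n)} {e : Fin n → ℚ},
        TorusRep.IsCircuitPartition s l I e →
        (Module.finrank K (TorusRep.cartanCandidate ρ hρ (TorusRep.blockMap b I fun _ => 1)) :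
          WithBot ℕ∞) = TorusRep.quotientDim ρ := by
    intro n b s hb l I e h
    rw [← h.range_blockMap hb hρ, h.finrank_range_blockMap, h.quotientDim_eq hb]
  obtain ⟨b, s, hb⟩ := TorusRep.exists_isWeightBasis hρ
  refine ⟨?_, ⟨b, s, hb⟩, fun n b s hb => ⟨?_, fun l I hI => ?_⟩⟩
  · obtain ⟨l, I, e, h⟩ := hexists _ b s hb
    exact ⟨_, hdim hb h⟩
  · obtain ⟨l, I, e, h⟩ := hexists n b s hb
    exact ⟨l, I, h.isBlockPartition⟩
  · obtain ⟨e, h⟩ := hI.exists_isCircuitPartition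
    exact ⟨h.range_blockMap hb hρ, ⟨_, h.range_blockMap hb hρ, hdim hb h⟩,
      h.finrank_range_blockMap, h.quotientDim_eq hb⟩
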